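/- Let $W$ be the triangle group $(2,b,c)$, i.e. the Coxeter group with simple generators $S=\{r,s,t\}$ and $m_{rs}=2$, $m_{rt}=b$, $m_{st}=c$, where $3\le b\le\infty$ and $3\le c<\infty$. Let $\ell$ be the length function and $\le$ the Bruhat order on $W$; for $w\in W$ put $P_w(q)=\sum_{x\le w}q^{\ell(x)}=\sum_i a_iq^i$. Call $w$ $k$-palindromic if $a_i=a_{\ell(w)-i}$ for all $0\le i<k$, and palindromic if this holds for all $i$. Then there exists an element of $W$ which is $(c-2)$-palindromic but not palindromic. More precisely, let $w=uv$, where $$u^{-1}=\underbrace{stst\cdots}_{c-1},\qquad v=\underbrace{rtstst\cdots}_{c-1}$$ (in $v$ the letter $r$ is followed by the first $c-2$ letters of $tsts\cdots$). Then $\ell(u)=\ell(v)=c-1$, $\ell(w)=2c-2$, $$P_w(q)=[2c-1]_q+q^{c}+\sum_{k=1}^{c-1}2q^k\,[2c-1-2k]_q,\qquad [n]_q=1+q+\cdots+q^{n-1},$$ and $w$ is $(c-2)$-palindromic but not palindromic. -/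

import Mathlib

open Polynomial

namespace CoxeterSystem

variable {B W : Type*} [Group W] {M : CoxeterMatrix B} (cs : CoxeterSystem M W)

/-- One step of the Bruhat order: `y = x * t` for some reflection `t`, and `ℓ x < ℓ y`. -/
def BruhatStep (x y : W) : Prop :=
  ∃ t : W, cs.IsReflection t ∧ y = x * t ∧ cs.length x < cs.length y

/-- The Bruhat order: `x ≤ y` if `y` is reached from `x` by finitely many (possibly zero)
length-increasing multiplications by reflections. -/
def BruhatLE : W → W → Prop := Relation.ReflTransGen cs.BruhatStep

theorem BruhatLE.length_le {cs : CoxeterSystem M W} {x y : W} (h : cs.BruhatLE x y) :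
    cs.length x ≤ cs.length y := by
  unfold BruhatLE at h
  induction h with
  | refl => exact le_rfl
  | tail _ h ih =>
    obtain ⟨t, _, _, hlt⟩ := h
    exact ih.trans hlt.le

/-- If there are finitely many simple generators, every lower Bruhat interval is finite. -/
theorem finite_bruhatInterval [Finite B] (w : W) : {x : W | cs.BruhatLE x w}.Finite := by
  refine ((List.finite_length_le B (cs.length w)).image cs.wordProd).subset ?_
  intro x hx
  obtain ⟨ω, hω, rfl⟩ := cs.exists_isReduced x
  exact ⟨ω, by simpa [hω.eq] using BruhatLE.length_le hx, rfl⟩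

/-- The Poincaré polynomial `P_w(q) = ∑_{x ≤ w} q ^ ℓ(x)`, the sum over the Bruhat interval
`[e, w]`. -/
noncomputable def poincarePolynomial [Finite B] (w : W) : ℕ[X] :=
  ∑ x ∈ (cs.finite_bruhatInterval w).toFinset, X ^ cs.length x

/-- `w` is `k`-palindromic if `a_i = a_{ℓ(w) - i}` for all `0 ≤ i < k`, where
`P_w(q) = ∑ a_i q ^ i`. (For `i > ℓ(w)` both coefficients of the equation are zero, the index on the
right being negative, so such `i` impose no condition.) -/
def IsKPalindromic [Finite B] (k : ℕ) (w : W) : Prop :=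
  ∀ i : ℕ, i < k → i ≤ cs.length w →
    (cs.poincarePolynomial w).coeff i = (cs.poincarePolynomial w).coeff (cs.length w - i)

/-- `w` is palindromic if `a_i = a_{ℓ(w) - i}` for all `i`, where `P_w(q) = ∑ a_i q ^ i`. -/
def IsPalindromic [Finite B] (w : W) : Prop :=
  ∀ i : ℕ, i ≤ cs.length w →
    (cs.poincarePolynomial w).coeff i = (cs.poincarePolynomial w).coeff (cs.length w - i)

/-- The alternating word `i j i j …` with `n` letters whose first letter is `i`. -/
def altWordFrom {B : Type*} (i j : B) : ℕ → List B
  | 0 => []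
  | n + 1 => i :: altWordFrom j i n

/-- The `q`-integer `[n]_q = 1 + q + ⋯ + q ^ (n - 1)`. -/
noncomputable def qInt (n : ℕ) : ℕ[X] := ∑ j ∈ Finset.range n, X ^ j

end CoxeterSystem

/-!
Let `q_n = t s t ⋯` with `n` letters. As `r` and `s` commute, the element in question is
`w = (s q_{c-2})⁻¹ r q_{c-2}`, and the proof lists the Bruhat interval below it.

The subword property says that the elements below `w` are the products of the subwords of a reduced
word of `w`. The subwords without `r` give the whole parabolic subgroup `W_J`, `J = {s, t}`,
which is dihedral of order `2c` and consists of the elements `s ^ e q_j` with `e < 2` and `j < c`,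
of length `e + j`. The subwords with `r` give the elements `(s ^ e q_i)⁻¹ r q_j` with `e < 2` and
`i, j ≤ c - 2`: any letter `s` at the beginning of the right factor can be moved across `r`. These
elements have length `e + i + j + 1` and are distinct and outside `W_J`, since `r q_j` is the
shortest element of the coset `W_J r q_j`. Hence `P_w = (1 + q) [c] + q (1 + q) [c-1]²`, and the
formula `[n]² = ∑_{k<n} q^k [2n-1-2k]` turns this into the stated polynomial. All its terms but `q^c`
are symmetric about the degree `c - 1`, so that the symmetry fails just between the degrees
`c - 2` and `c`.

What this needs from the theory of Coxeter groups is established for arbitrary Coxeter systems: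
* the geometric representation `geomRep` shows that `s_i s_j` has no smaller order than prescribed
  (`dvd_of_simple_mul_simple_pow_eq_one`) and that a simple reflection is in a standard parabolic
  subgroup only if it is one of its generators (`simple_mem_parabolic_iff`);
* the action of `W` on `W × ZMod 2` that records the parity of the number of occurrences of a
  reflection in an inversion sequence gives the strong exchange property
  (`IsRightInversion.exists_eraseIdx`), and this in turn gives the subword property
  (`IsReduced.bruhatLE_iff`) and the additivity of lengths in parabolic cosets
  (`length_mul_of_forall_not_isLeftDescent`).
-/

namespace CoxeterSystem

variable {B W : Type*} [Group W] {M : CoxeterMatrix B} (cs : CoxeterSystem M W)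

/-! ### The geometric representation -/

/-- The coroot of `i` in the geometric representation, on the space with basis the simple roots:
the linear form `α_j ↦ -2 cos (π / M i j)`. With Lean's `π / 0 = 0`, an entry `0` of `M`, which
stands for `∞`, gives the value `-2`, as it should. -/
noncomputable def geomCoroot (M : CoxeterMatrix B) (i : B) : Module.Dual ℝ (B →₀ ℝ) :=
  Finsupp.linearCombination ℝ fun j ↦ -(2 * Real.cos (Real.pi / M i j))

theorem geomCoroot_single (i j : B) :
    geomCoroot M i (Finsupp.single j 1) = -(2 * Real.cos (Real.pi / M i j)) := by
  simp [geomCoroot]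

theorem geomCoroot_single_self (i : B) : geomCoroot M i (Finsupp.single i 1) = 2 := by
  simp [geomCoroot_single]

theorem geomCoroot_mul_geomCoroot_sub_two (i j : B) :
    geomCoroot M i (Finsupp.single j 1) * geomCoroot M j (Finsupp.single i 1) - 2 =
      2 * Real.cos (2 * (Real.pi / M i j)) := by
  rw [geomCoroot_single, geomCoroot_single, M.symmetric j i, Real.cos_two_mul]
  ring

/-- The reflection in the simple root `α_i`. -/
noncomputable def geomReflection (M : CoxeterMatrix B) (i : B) : (B →₀ ℝ) ≃ₗ[ℝ] (B →₀ ℝ) :=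
  Module.reflection (geomCoroot_single_self (M := M) i)

theorem geomReflection_mul_self (i : B) : geomReflection M i * geomReflection M i = 1 :=
  mul_eq_one_iff_eq_inv.2 (Module.reflection_inv (geomCoroot_single_self i)).symm

theorem sin_two_mul_pi_div_ne_zero {m : ℕ} (hm : 3 ≤ m) :
    Real.sin (2 * (Real.pi / m)) ≠ 0 := by
  have hm' : (3 : ℝ) ≤ m := by exact_mod_cast hm
  refine (Real.sin_pos_of_pos_of_lt_pi (by positivity) ?_).ne'
  rw [← mul_div_assoc, div_lt_iff₀ (by positivity)]
  nlinarith [Real.pi_pos]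

open Chebyshev in
theorem isLiftable_geomReflection : M.IsLiftable (geomReflection M) := by
  intro i j
  obtain hm | hm | hm | hm : M i j = 0 ∨ M i j = 1 ∨ M i j = 2 ∨ 3 ≤ M i j := by omega
  · rw [hm, pow_zero]
  · obtain rfl : i = j := by
      by_contra h
      exact M.off_diagonal i j h hm
    rw [hm, pow_one, geomReflection_mul_self]
  · -- The two roots are orthogonal, so the reflections commute.
    rw [hm, pow_two]
    ext1 v
    have h₁ : geomCoroot M i (Finsupp.single j 1) = 0 := by simp [geomCoroot_single, hm]
    have h₂ : geomCoroot M j (Finsupp.single i 1) = 0 := by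
      simp [geomCoroot_single, M.symmetric j i, hm]
    simp only [geomReflection, LinearEquiv.mul_apply, LinearEquiv.coe_one, id,
      Module.reflection_apply, map_sub, map_smul, h₁, h₂, geomCoroot_single_self]
    module
  · set a : ℝ := 2 * (Real.pi / M i j) with ha
    have hsin : Real.sin a ≠ 0 := sin_two_mul_pi_div_ne_zero hm
    have hM : (M i j : ℝ) ≠ 0 := by positivity
    ext1 v
    rw [geomReflection, geomReflection, Module.reflection_mul_reflection_pow_apply _ _ _ _
      (2 * Real.cos a) (geomCoroot_mul_geomCoroot_sub_two i j).symm]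
    obtain ⟨k, hk | hk⟩ := Nat.even_or_odd' (M i j)
    · have h₀ : (S ℝ ((k : ℤ) - 1)).eval (2 * Real.cos a) = 0 := by
        refine (mul_eq_zero.1 ((S_two_mul_real_cos a _).trans ?_)).resolve_right hsin
        rw [← Real.sin_pi]
        congr 1
        rw [ha]
        have hk' : (k : ℝ) ≠ 0 := by
          rw [hk] at hm
          exact_mod_cast (by omega : k ≠ 0)
        rw [hk]
        push_cast
        field_simp
        ring
      have e₁ : ((M i j : ℤ) - 2) / 2 = k - 1 := by omega
      have e₂ : ((M i j : ℤ) - 1) / 2 = k - 1 := by omega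
      rw [e₁, e₂, h₀]
      simp
    · have h₀ : (S ℝ (k : ℤ)).eval (2 * Real.cos a) +
          (S ℝ ((k : ℤ) - 1)).eval (2 * Real.cos a) = 0 := by
        refine (mul_eq_zero.1 (?_ : _ * Real.sin a = 0)).resolve_right hsin
        rw [add_mul, S_two_mul_real_cos, S_two_mul_real_cos, Real.sin_add_sin]
        have : Real.sin ((((k : ℤ) + 1) * a + (((k : ℤ) - 1 : ℤ) + 1) * a) / 2) = 0 := by
          rw [← Real.sin_pi]
          congr 1
          rw [ha]
          rw [hk] at hM ⊢
          push_cast at hM ⊢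
          field_simp
          ring
        rw [this]
        ring
      have e₁ : ((M i j : ℤ) - 2) / 2 = k - 1 := by omega
      have e₂ : ((M i j : ℤ) - 1) / 2 = k := by omega
      have e₃ : ((M i j : ℤ) - 3) / 2 = k - 1 := by omega
      have e₄ : (M i j : ℤ) / 2 = k := by omega
      rw [e₁, e₂, e₃, e₄, h₀]
      simp

/-- The geometric representation of a Coxeter group on the real vector space with basis the simple
roots. -/
noncomputable def geomRep : W →* ((B →₀ ℝ) ≃ₗ[ℝ] (B →₀ ℝ)) :=
  cs.lift ⟨geomReflection M, isLiftable_geomReflection⟩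

theorem geomRep_simple (i : B) : cs.geomRep (cs.simple i) = geomReflection M i :=
  cs.lift_apply_simple _ i

open Chebyshev in
/-- The order of `s_i s_j` is no smaller than prescribed by the Coxeter matrix, because it acts on
the plane of `α_i` and `α_j` as a rotation by `2π / M i j`, or as a shear if `M i j = 0`. -/
theorem dvd_of_simple_mul_simple_pow_eq_one {i j : B} (hM : M i j = 0 ∨ 3 ≤ M i j) {k : ℕ}
    (h : (cs.simple i * cs.simple j) ^ k = 1) : M i j ∣ k := by
  have hij : i ≠ j := by
    rintro rfl
    simp at hM
  replace h := LinearEquiv.congr_fun (congrArg cs.geomRep h) (Finsupp.single i 1)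
  rw [map_pow, map_mul, geomRep_simple, geomRep_simple, geomReflection, geomReflection,
    Module.reflection_mul_reflection_pow_apply_self _ _ _
      (2 * Real.cos (2 * (Real.pi / M i j))) (geomCoroot_mul_geomCoroot_sub_two i j).symm,
    map_one] at h
  have h₁ := DFunLike.congr_fun h i
  have h₂ := DFunLike.congr_fun h j
  simp [hij, hij.symm, geomCoroot_single, M.symmetric j i] at h₁ h₂
  obtain hm | hm := hM
  · simp [hm, S_eval_two] at h₂ ⊢
    exact h₂
  · have hm' : (3 : ℝ) ≤ M i j := by exact_mod_cast hm
    have hsin := sin_two_mul_pi_div_ne_zero hm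
    have hcos : Real.cos (Real.pi / M i j) ≠ 0 := by
      refine (Real.cos_pos_of_mem_Ioo ⟨?_, ?_⟩).ne'
      · have : 0 < Real.pi / M i j := by positivity
        linarith [Real.pi_pos]
      · exact div_lt_div_of_pos_left Real.pi_pos (by norm_num) (by linarith)
    set a : ℝ := 2 * (Real.pi / M i j) with ha
    have h₃ := h₂.resolve_right hcos
    rw [h₃, add_zero] at h₁
    have s₁ := S_two_mul_real_cos a k
    have s₂ := S_two_mul_real_cos a ((k : ℤ) - 1)
    rw [h₁] at s₁
    rw [h₃] at s₂
    push_cast at s₁ s₂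
    rw [sub_add_cancel] at s₂
    rw [add_mul, one_mul, one_mul, Real.sin_add, ← s₂] at s₁
    have s₃ : Real.cos (k * a) = 1 := by
      apply mul_right_cancel₀ hsin
      linarith
    obtain ⟨n, hn⟩ := (Real.cos_eq_one_iff _).1 s₃
    have : (k : ℝ) = n * M i j := by
      rw [ha] at hn
      field_simp at hn
      nlinarith [Real.pi_pos]
    have : (k : ℤ) = n * M i j := by exact_mod_cast this
    exact Int.natCast_dvd_natCast.1 ⟨n, by rw [this]; ring⟩

/-! ### The strong exchange property -/

open Classical in
/-- The action of a simple reflection on `W × ZMod 2` by conjugation on the first factor, with a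
sign change exactly over the simple reflection itself. It keeps track of the parity with which an
element occurs in a right inversion sequence. -/
noncomputable def inversionPerm (i : B) : Equiv.Perm (W × ZMod 2) :=
  Function.Involutive.toPerm
    (fun p ↦ (cs.simple i * p.1 * cs.simple i, p.2 + if p.1 = cs.simple i then 1 else 0)) <| by
    rintro ⟨t, e⟩
    have h : cs.simple i * t * cs.simple i = cs.simple i ↔ t = cs.simple i := by
      rw [mul_eq_right, mul_eq_one_iff_inv_eq, inv_simple, eq_comm]
    ext
    · simp [mul_assoc]
    · simp only [h]
      split_ifs <;> simp [add_assoc, CharTwo.add_self_eq_zero]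

open Classical in
theorem prod_map_inversionPerm (ω : List B) (t : W) (e : ZMod 2) :
    (ω.map cs.inversionPerm).prod (t, e) =
      (cs.wordProd ω * t * (cs.wordProd ω)⁻¹, e + (cs.rightInvSeq ω).count t) := by
  induction ω with
  | nil => simp
  | cons i ω ih =>
    have h : cs.wordProd ω * t * (cs.wordProd ω)⁻¹ = cs.simple i ↔
        (cs.wordProd ω)⁻¹ * cs.simple i * cs.wordProd ω = t := by
      constructor
      · intro h
        rw [← h]
        group
      · intro h
        rw [← h]
        group
    rw [List.map_cons, List.prod_cons, Equiv.Perm.mul_apply, ih]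
    simp only [mul_assoc] at h
    simp [inversionPerm, rightInvSeq, wordProd_cons, List.count_cons, h, mul_assoc, add_assoc]

theorem prod_map_reverse_altWordFrom {G : Type*} [Monoid G] (f : B → G) (i j : B) (m : ℕ) :
    ((altWordFrom i j (2 * m)).reverse.map f).prod = (f j * f i) ^ m := by
  induction m with
  | zero => simp [altWordFrom]
  | succ m ih =>
    rw [pow_succ, ← ih, show 2 * (m + 1) = 2 * m + 1 + 1 by ring]
    simp [altWordFrom]

theorem leftInvSeq_altWordFrom (i j : B) (n : ℕ) :
    cs.leftInvSeq (altWordFrom i j n) =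
      (List.range n).map fun k ↦ cs.simple i * (cs.simple j * cs.simple i) ^ k := by
  induction n generalizing i j with
  | zero => rfl
  | succ n ih =>
    rw [altWordFrom, leftInvSeq, ih, List.range_succ_eq_map, List.map_cons, List.map_map,
      List.map_map, pow_zero, mul_one]
    congr 1
    refine List.map_congr_left fun k _ ↦ ?_
    simp only [Function.comp_apply, MulAut.conj_apply, inv_simple, pow_succ']
    simp [mul_assoc, mul_pow_mul]

/-- The left inversion sequence of the alternating word of length `2 * M i j` is some list repeated
twice, since `s_i s_j` has a power equal to `1`. -/
theorem isLiftable_inversionPerm : M.IsLiftable cs.inversionPerm := by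
  classical
  intro i j
  ext1 ⟨t, e⟩
  rw [← prod_map_reverse_altWordFrom, prod_map_inversionPerm, rightInvSeq_reverse,
    leftInvSeq_altWordFrom, List.count_reverse, two_mul, List.range_add, List.map_append,
    List.map_map, List.count_append]
  have h₁ : cs.wordProd (altWordFrom j i (M i j + M i j)).reverse = 1 := by
    rw [wordProd, ← two_mul, prod_map_reverse_altWordFrom, simple_mul_simple_pow]
  have h₂ : ((fun k ↦ cs.simple j * (cs.simple i * cs.simple j) ^ k) ∘ fun k ↦ M i j + k) =
      fun k ↦ cs.simple j * (cs.simple i * cs.simple j) ^ k := by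
    ext k
    simp [pow_add]
  rw [h₁, h₂]
  simp [CharTwo.add_self_eq_zero]

/-- The action of a Coxeter group on `W × ZMod 2` that extends `inversionPerm`. -/
noncomputable def inversionAction : W →* Equiv.Perm (W × ZMod 2) :=
  cs.lift ⟨cs.inversionPerm, cs.isLiftable_inversionPerm⟩

open Classical in
theorem inversionAction_wordProd (ω : List B) (t : W) (e : ZMod 2) :
    cs.inversionAction (cs.wordProd ω) (t, e) =
      (cs.wordProd ω * t * (cs.wordProd ω)⁻¹, e + (cs.rightInvSeq ω).count t) := by
  rw [← prod_map_inversionPerm, wordProd, map_list_prod, List.map_map]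
  congr 2
  refine List.map_congr_left fun i _ ↦ cs.lift_apply_simple _ i

/-- The parity with which `t` occurs in the right inversion sequence of a word for `w`. -/
noncomputable def inversionParity (w t : W) : ZMod 2 := (cs.inversionAction w (t, 0)).2

open Classical in
theorem inversionParity_wordProd (ω : List B) (t : W) :
    cs.inversionParity (cs.wordProd ω) t = (cs.rightInvSeq ω).count t := by
  simp [inversionParity, inversionAction_wordProd]

theorem inversionAction_apply (w t : W) (e : ZMod 2) :
    cs.inversionAction w (t, e) = (w * t * w⁻¹, e + cs.inversionParity w t) := by
  obtain ⟨ω, rfl⟩ := cs.wordProd_surjective w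
  rw [inversionAction_wordProd, inversionParity_wordProd]

theorem inversionParity_mul (w w' t : W) :
    cs.inversionParity (w * w') t =
      cs.inversionParity w' t + cs.inversionParity w (w' * t * w'⁻¹) := by
  rw [inversionParity, map_mul, Equiv.Perm.mul_apply, inversionAction_apply, inversionAction_apply,
    zero_add]

theorem inversionParity_one (t : W) : cs.inversionParity 1 t = 0 := by
  simp [inversionParity]

theorem IsReflection.inversionParity_self {cs : CoxeterSystem M W} {t : W}
    (ht : cs.IsReflection t) : cs.inversionParity t t = 1 := by
  classical
  obtain ⟨w, i, rfl⟩ := ht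
  have h₁ : w⁻¹ * (w * cs.simple i * w⁻¹) * w⁻¹⁻¹ = cs.simple i := by group
  have h₂ : cs.inversionParity (cs.simple i) (cs.simple i) = 1 := by
    rw [← wordProd_singleton, inversionParity_wordProd]
    simp
  have h₃ := cs.inversionParity_mul w w⁻¹ (w * cs.simple i * w⁻¹)
  rw [mul_inv_cancel, inversionParity_one, h₁] at h₃
  rw [inversionParity_mul, h₁, inversionParity_mul, h₂, mul_inv_cancel_right]
  linear_combination -h₃

theorem mem_rightInvSeq_of_inversionParity_eq_one {ω : List B} {t : W}
    (h : cs.inversionParity (cs.wordProd ω) t = 1) : t ∈ cs.rightInvSeq ω := by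
  classical
  rw [inversionParity_wordProd] at h
  by_contra hmem
  rw [List.count_eq_zero_of_not_mem hmem] at h
  simp at h

theorem length_mul_lt_of_inversionParity_eq_one {w t : W} (h : cs.inversionParity w t = 1) :
    cs.length (w * t) < cs.length w := by
  obtain ⟨ω, hω, rfl⟩ := cs.exists_isReduced w
  exact (cs.isRightInversion_of_mem_rightInvSeq hω
    (cs.mem_rightInvSeq_of_inversionParity_eq_one h)).2

theorem IsRightInversion.inversionParity_eq_one {cs : CoxeterSystem M W} {w t : W}
    (h : cs.IsRightInversion w t) : cs.inversionParity w t = 1 := by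
  have h₁ := cs.inversionParity_mul w t t
  rw [h.1.inversionParity_self, mul_inv_cancel_right] at h₁
  have h₂ : cs.inversionParity (w * t) t ≠ 1 := fun h₂ ↦ by
    have := cs.length_mul_lt_of_inversionParity_eq_one h₂
    rw [mul_assoc, h.1.mul_self, mul_one] at this
    exact lt_asymm this h.2
  generalize cs.inversionParity (w * t) t = a at *
  generalize cs.inversionParity w t = b at *
  revert a b
  decide

/-- The strong exchange property, for words that need not be reduced. -/
theorem IsRightInversion.exists_eraseIdx {cs : CoxeterSystem M W} {ω : List B} {t : W}
    (h : cs.IsRightInversion (cs.wordProd ω) t) :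
    ∃ j < ω.length, cs.wordProd ω * t = cs.wordProd (ω.eraseIdx j) := by
  obtain ⟨j, hj, rfl⟩ := List.mem_iff_getElem.1
    (cs.mem_rightInvSeq_of_inversionParity_eq_one h.inversionParity_eq_one)
  refine ⟨j, by simpa using hj, ?_⟩
  rw [← wordProd_mul_getD_rightInvSeq, List.getD_eq_getElem]

/-- The exchange property: multiplying by a left descent amounts to deleting a letter. -/
theorem IsLeftDescent.exists_eraseIdx {cs : CoxeterSystem M W} {ω : List B} {i : B}
    (h : cs.IsLeftDescent (cs.wordProd ω) i) :
    ∃ j < ω.length, cs.simple i * cs.wordProd ω = cs.wordProd (ω.eraseIdx j) := by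
  have ht : cs.IsReflection ((cs.wordProd ω)⁻¹ * cs.simple i * cs.wordProd ω) := by
    simpa using (cs.isReflection_simple i).conj (cs.wordProd ω)⁻¹
  have hmul : cs.wordProd ω * ((cs.wordProd ω)⁻¹ * cs.simple i * cs.wordProd ω) =
      cs.simple i * cs.wordProd ω := by group
  rw [← hmul]
  exact IsRightInversion.exists_eraseIdx ⟨ht, by rwa [hmul]⟩

theorem length_wordProd_eraseIdx_lt {ω : List B} {j : ℕ} (hj : j < ω.length) :
    cs.length (cs.wordProd (ω.eraseIdx j)) < ω.length := by
  have := cs.length_wordProd_le (ω.eraseIdx j)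
  have := List.length_eraseIdx_add_one hj
  omega

/-- The reflections in the inversion sequence of a word are distinct only if the word is reduced:
each of them then occurs with odd multiplicity, so that it is an inversion. -/
theorem isReduced_of_nodup_rightInvSeq {ω : List B} (h : (cs.rightInvSeq ω).Nodup) :
    cs.IsReduced ω := by
  classical
  obtain ⟨ω', hω', heq⟩ := cs.exists_isReduced (cs.wordProd ω)
  have hsub : cs.rightInvSeq ω ⊆ cs.rightInvSeq ω' := fun t ht ↦ by
    apply cs.mem_rightInvSeq_of_inversionParity_eq_one
    rw [← heq, inversionParity_wordProd, List.count_eq_one_of_mem h ht, Nat.cast_one]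
  have hle := (h.subperm hsub).length_le
  rw [length_rightInvSeq, length_rightInvSeq, ← hω'.eq, ← heq] at hle
  exact le_antisymm (cs.length_wordProd_le ω) hle

/-! ### The subword property of the Bruhat order -/

theorem bruhatStep_or_bruhatStep_mul_simple (w : W) (i : B) :
    cs.BruhatStep w (w * cs.simple i) ∨ cs.BruhatStep (w * cs.simple i) w := by
  have h := cs.isReflection_simple i
  rcases cs.length_mul_simple w i with hw | hw
  · exact .inl ⟨_, h, rfl, by omega⟩
  · exact .inr ⟨_, h, by simp, by omega⟩

theorem BruhatStep.mul_simple {cs : CoxeterSystem M W} {x y : W} (h : cs.BruhatStep x y) (i : B) :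
    cs.BruhatLE (x * cs.simple i) y ∨ cs.BruhatLE (x * cs.simple i) (y * cs.simple i) := by
  rcases cs.bruhatStep_or_bruhatStep_mul_simple x i with hx | hx
  swap
  · exact .inl (.head hx (.single h))
  obtain ⟨t, ht, rfl, hlt⟩ := h
  have ht' : cs.IsReflection (cs.simple i * t * cs.simple i) := by
    simpa using ht.conj (cs.simple i)
  have hmul : x * cs.simple i * (cs.simple i * t * cs.simple i) = x * t * cs.simple i := by
    simp [mul_assoc]
  rcases lt_or_gt_of_ne (ht'.length_mul_left_ne (x * cs.simple i)) with hlt' | hlt'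
  swap
  · exact .inr (.single ⟨_, ht', hmul.symm, by rwa [hmul] at hlt'⟩)
  -- Now `x * t * s i` arises from a reduced word of `x * s i` by deleting a letter; for reasons of
  -- length it can only be the last one.
  left
  obtain ⟨ω, hω, rfl⟩ := cs.exists_isReduced x
  rw [← wordProd_concat, List.concat_eq_append] at hlt' hmul
  obtain ⟨j, hj, h⟩ := IsRightInversion.exists_eraseIdx ⟨ht', hlt'⟩
  rw [hmul] at h
  rw [List.length_append, List.length_singleton] at hj
  obtain hj | rfl : j < ω.length ∨ j = ω.length := by omega
  · rw [List.eraseIdx_append_of_lt_length hj, ← List.concat_eq_append, wordProd_concat,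
      mul_left_inj] at h
    have := cs.length_wordProd_eraseIdx_lt hj
    rw [← h] at this
    have := hω.eq
    omega
  · rw [List.eraseIdx_append_of_length_le le_rfl, Nat.sub_self, List.eraseIdx_cons_zero,
      List.append_nil] at h
    rw [eq_mul_inv_of_mul_eq h, inv_simple]
    exact .refl

theorem BruhatLE.mul_simple {cs : CoxeterSystem M W} {x y : W} (h : cs.BruhatLE x y) (i : B) :
    cs.BruhatLE (x * cs.simple i) y ∨ cs.BruhatLE (x * cs.simple i) (y * cs.simple i) := by
  induction h with
  | refl => exact .inr .refl
  | tail _ h ih =>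
    rcases ih with ih | ih
    · exact .inl (ih.tail h)
    · exact (h.mul_simple i).imp ih.trans ih.trans

theorem BruhatLE.exists_sublist {cs : CoxeterSystem M W} {x : W} {ω : List B}
    (h : cs.BruhatLE x (cs.wordProd ω)) : ∃ ω', ω'.Sublist ω ∧ cs.wordProd ω' = x := by
  induction h using Relation.ReflTransGen.head_induction_on with
  | refl => exact ⟨ω, List.Sublist.refl ω, rfl⟩
  | head h _ ih =>
    obtain ⟨ω', hsub, rfl⟩ := ih
    obtain ⟨t, ht, heq, hlt⟩ := h
    obtain rfl := eq_mul_inv_of_mul_eq heq.symm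
    rw [ht.inv] at hlt ⊢
    obtain ⟨j, _, h⟩ := IsRightInversion.exists_eraseIdx ⟨ht, hlt⟩
    exact ⟨_, (List.eraseIdx_sublist ω' j).trans hsub, h.symm⟩

theorem IsReduced.bruhatLE_of_sublist {cs : CoxeterSystem M W} {ω ω' : List B}
    (hω : cs.IsReduced ω) (h : ω'.Sublist ω) :
    cs.BruhatLE (cs.wordProd ω') (cs.wordProd ω) := by
  induction ω using List.reverseRecOn generalizing ω' with
  | nil =>
    rw [List.sublist_nil.1 h]
    exact .refl
  | append_singleton ω i ih =>
    have hω₁ : cs.IsReduced ω := by simpa using hω.take ω.length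
    have hstep : cs.BruhatStep (cs.wordProd ω) (cs.wordProd (ω ++ [i])) := by
      refine ⟨_, cs.isReflection_simple i, by simp [wordProd_append], ?_⟩
      rw [hω.eq, hω₁.eq]
      simp
    obtain ⟨ω₁, ω₂, rfl, h₁, h₂⟩ := List.sublist_append_iff.1 h
    rcases List.sublist_singleton.1 h₂ with rfl | rfl
    · rw [List.append_nil]
      exact (ih hω₁ h₁).tail hstep
    · rw [wordProd_append, wordProd_singleton]
      rcases (ih hω₁ h₁).mul_simple i with h | h
      · exact h.tail hstep
      · simpa [wordProd_append] using h

/-- The subword property: below a reduced word lie the products of its subwords. -/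
theorem IsReduced.bruhatLE_iff {cs : CoxeterSystem M W} {ω : List B} (hω : cs.IsReduced ω)
    {x : W} : cs.BruhatLE x (cs.wordProd ω) ↔ ∃ ω', ω'.Sublist ω ∧ cs.wordProd ω' = x :=
  ⟨BruhatLE.exists_sublist, fun ⟨_, h, hx⟩ ↦ hx ▸ hω.bruhatLE_of_sublist h⟩

/-! ### Standard parabolic subgroups -/

/-- The standard parabolic subgroup generated by the simple reflections in `J`. -/
def parabolic (J : Set B) : Subgroup W := Subgroup.closure (cs.simple '' J)

variable {cs} {J : Set B}

theorem simple_mem_parabolic {i : B} (hi : i ∈ J) : cs.simple i ∈ cs.parabolic J :=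
  Subgroup.subset_closure ⟨i, hi, rfl⟩

theorem wordProd_mem_parabolic {ω : List B} (hω : ∀ i ∈ ω, i ∈ J) :
    cs.wordProd ω ∈ cs.parabolic J := by
  refine list_prod_mem fun w hw ↦ ?_
  obtain ⟨i, hi, rfl⟩ := List.mem_map.1 hw
  exact simple_mem_parabolic (hω i hi)

theorem exists_wordProd_eq_of_mem_parabolic {w : W} (hw : w ∈ cs.parabolic J) :
    ∃ ω : List B, (∀ i ∈ ω, i ∈ J) ∧ cs.wordProd ω = w := by
  induction hw using Subgroup.closure_induction with
  | mem x hx =>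
    obtain ⟨i, hi, rfl⟩ := hx
    exact ⟨[i], by simpa using hi, cs.wordProd_singleton i⟩
  | one => exact ⟨[], by simp, cs.wordProd_nil⟩
  | mul x y _ _ hx hy =>
    obtain ⟨ω, hω, rfl⟩ := hx
    obtain ⟨ω', hω', rfl⟩ := hy
    exact ⟨ω ++ ω', by simpa [or_imp, forall_and] using ⟨hω, hω'⟩, cs.wordProd_append ω ω'⟩
  | inv x _ hx =>
    obtain ⟨ω, hω, rfl⟩ := hx
    exact ⟨ω.reverse, by simpa using hω, cs.wordProd_reverse ω⟩

theorem exists_reduced_sublist (ω : List B) :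
    ∃ ω' : List B, ω'.Sublist ω ∧ cs.IsReduced ω' ∧ cs.wordProd ω' = cs.wordProd ω := by
  induction ω with
  | nil => exact ⟨[], .refl _, by simp [IsReduced], rfl⟩
  | cons i ω ih =>
    obtain ⟨ω', hsub, hred, heq⟩ := ih
    rw [wordProd_cons, ← heq]
    by_cases h : cs.IsLeftDescent (cs.wordProd ω') i
    · obtain ⟨j, hj, hex⟩ := h.exists_eraseIdx
      refine ⟨ω'.eraseIdx j, ((List.eraseIdx_sublist ω' j).trans hsub).cons i, ?_, hex.symm⟩
      rw [isLeftDescent_iff, hex, hred.eq] at h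
      rw [IsReduced]
      have := List.length_eraseIdx_add_one hj
      omega
    · refine ⟨i :: ω', hsub.cons_cons i, ?_, cs.wordProd_cons i ω'⟩
      rw [not_isLeftDescent_iff, hred.eq] at h
      rw [IsReduced, wordProd_cons, h, List.length_cons]

theorem exists_isReduced_of_mem_parabolic {w : W} (hw : w ∈ cs.parabolic J) :
    ∃ ω : List B, (∀ i ∈ ω, i ∈ J) ∧ cs.IsReduced ω ∧ cs.wordProd ω = w := by
  obtain ⟨ω, hω, rfl⟩ := exists_wordProd_eq_of_mem_parabolic hw
  obtain ⟨ω', hsub, hred, heq⟩ := cs.exists_reduced_sublist ω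
  exact ⟨ω', fun i hi ↦ hω i (hsub.subset hi), hred, heq⟩

theorem geomRep_sub_mem_supported {w : W} (hw : w ∈ cs.parabolic J) (v : B →₀ ℝ) :
    cs.geomRep w v - v ∈ Finsupp.supported ℝ ℝ J := by
  obtain ⟨ω, hω, rfl⟩ := exists_wordProd_eq_of_mem_parabolic hw
  clear hw
  induction ω with
  | nil => simp
  | cons i ω ih =>
    simp only [List.mem_cons, forall_eq_or_imp] at hω
    rw [wordProd_cons, map_mul, LinearEquiv.mul_apply, geomRep_simple, geomReflection,
      Module.reflection_apply, sub_right_comm]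
    exact sub_mem (ih hω.2)
      (Submodule.smul_mem _ _ (Finsupp.single_mem_supported ℝ 1 hω.1))

/-- A parabolic subgroup only moves a vector along its own simple roots, while the reflection `s i`
negates `α_i`. -/
theorem simple_mem_parabolic_iff {i : B} : cs.simple i ∈ cs.parabolic J ↔ i ∈ J := by
  refine ⟨fun h ↦ ?_, simple_mem_parabolic⟩
  have h' := geomRep_sub_mem_supported h (Finsupp.single i 1)
  rw [geomRep_simple, geomReflection, Module.reflection_apply_self] at h'
  refine (Finsupp.mem_supported ℝ _).1 h' ?_
  simp only [Finset.mem_coe, Finsupp.mem_support_iff, Finsupp.coe_sub, Finsupp.coe_neg,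
    Pi.sub_apply, Pi.neg_apply, Finsupp.single_eq_same]
  norm_num

theorem length_simple_mul_of_mem_parabolic {i : B} (hi : i ∉ J) {w : W}
    (hw : w ∈ cs.parabolic J) : cs.length (cs.simple i * w) = cs.length w + 1 := by
  rw [← not_isLeftDescent_iff]
  intro h
  obtain ⟨ω, hω, rfl⟩ := exists_wordProd_eq_of_mem_parabolic hw
  obtain ⟨j, _, hex⟩ := h.exists_eraseIdx
  have hmem : cs.wordProd (ω.eraseIdx j) ∈ cs.parabolic J :=
    wordProd_mem_parabolic fun i hi ↦ hω i ((List.eraseIdx_sublist ω j).subset hi)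
  rw [← hex] at hmem
  exact hi (simple_mem_parabolic_iff.1 ((Subgroup.mul_mem_cancel_right _ hw).1 hmem))

theorem length_mul_of_forall_le {x : W}
    (hx : ∀ a ∈ cs.parabolic J, cs.length x ≤ cs.length (a * x)) {a : W}
    (ha : a ∈ cs.parabolic J) : cs.length (a * x) = cs.length a + cs.length x := by
  obtain ⟨ω, hω, hred, rfl⟩ := exists_isReduced_of_mem_parabolic ha
  clear ha
  induction ω with
  | nil => simp
  | cons i ω ih =>
    simp only [List.mem_cons, forall_eq_or_imp] at hω
    have hred' : cs.IsReduced ω := hred.drop 1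
    specialize ih hω.2 hred'
    have hmem : cs.wordProd ω ∈ cs.parabolic J := wordProd_mem_parabolic hω.2
    have hi : cs.simple i ∈ cs.parabolic J := simple_mem_parabolic hω.1
    suffices h : ¬ cs.IsLeftDescent (cs.wordProd ω * x) i by
      rw [not_isLeftDescent_iff, ih, hred'.eq] at h
      rw [hred.eq, wordProd_cons, mul_assoc, h, List.length_cons]
      ring
    intro h
    obtain ⟨ξ, hξ, rfl⟩ := cs.exists_isReduced x
    rw [← wordProd_append] at h
    obtain ⟨j, hj, hex⟩ := h.exists_eraseIdx
    rw [List.length_append] at hj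
    by_cases hjω : j < ω.length
    · rw [List.eraseIdx_append_of_lt_length hjω, wordProd_append, wordProd_append, ← mul_assoc,
        mul_left_inj, ← wordProd_cons] at hex
      have := cs.length_wordProd_eraseIdx_lt hjω
      rw [← hex, hred.eq, List.length_cons] at this
      omega
    · rw [List.eraseIdx_append_of_length_le (by omega), wordProd_append, wordProd_append,
        ← inv_mul_eq_iff_eq_mul, ← mul_assoc, ← mul_assoc] at hex
      have h₁ := hx _ (mul_mem (mul_mem (inv_mem hmem) hi) hmem)
      have h₂ := cs.length_wordProd_eraseIdx_lt (ω := ξ) (j := j - ω.length) (by omega)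
      rw [hex, hξ.eq] at h₁
      omega

/-- An element without left descents in `J` is the shortest element of its coset, and lengths add
up. -/
theorem length_mul_of_forall_not_isLeftDescent {x : W} (hx : ∀ i ∈ J, ¬ cs.IsLeftDescent x i)
    {a : W} (ha : a ∈ cs.parabolic J) : cs.length (a * x) = cs.length a + cs.length x := by
  obtain ⟨⟨b, hb⟩, hmin⟩ : ∃ b : cs.parabolic J, ∀ b' : cs.parabolic J,
      cs.length (b * x) ≤ cs.length (b' * x) :=
    ⟨_, fun b' ↦ Function.argmin_le (fun b : cs.parabolic J ↦ cs.length (b * x)) b'⟩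
  have hy : ∀ a ∈ cs.parabolic J, cs.length (b * x) ≤ cs.length (a * (b * x)) := fun a ha ↦ by
    rw [← mul_assoc]
    exact hmin ⟨a * b, mul_mem ha hb⟩
  obtain ⟨ω, hω, hred, heq⟩ := exists_isReduced_of_mem_parabolic (inv_mem hb)
  cases ω with
  | nil =>
    obtain rfl : b = 1 := by simpa [eq_comm] using heq
    rw [one_mul] at hy
    exact length_mul_of_forall_le hy ha
  | cons i ω =>
    simp only [List.mem_cons, forall_eq_or_imp] at hω
    refine absurd ?_ (hx i hω.1)
    have h₁ := length_mul_of_forall_le hy (inv_mem hb)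
    have h₂ := length_mul_of_forall_le hy (wordProd_mem_parabolic hω.2)
    have h₃ : cs.simple i * x = cs.wordProd ω * (b * x) := by
      have : cs.wordProd ω = cs.simple i * b⁻¹ := by
        rw [← heq, wordProd_cons, simple_mul_simple_cancel_left]
      rw [this]
      group
    rw [inv_mul_cancel_left, ← heq, hred.eq, List.length_cons] at h₁
    have h₄ := cs.length_wordProd_le ω
    rw [IsLeftDescent, h₃]
    omega

/-- Lengths in the double coset of the reflection `r` with respect to the parabolic subgroup of
`{s, t}`, where `r` commutes with `s` but not with `t`: the product `r b` has no left descent in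
`{s, t}`, as `t` could only be one if `r t r` belonged to the parabolic subgroup. -/
theorem length_mul_simple_mul {r s t : B} (hrs : M r s = 2) (hrt : M r t = 0 ∨ 3 ≤ M r t)
    {a b : W} (ha : a ∈ cs.parabolic {s, t}) (hb : b ∈ cs.parabolic {s, t})
    (hsb : ¬ cs.IsLeftDescent b s) :
    cs.length (a * (cs.simple r * b)) = cs.length a + (cs.length b + 1) := by
  have hne_rs : r ≠ s := by rintro rfl; simp at hrs
  have hne_rt : r ≠ t := by rintro rfl; simp at hrt
  have hne_st : s ≠ t := by rintro rfl; omega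
  have hr : r ∉ ({s, t} : Set B) := by simp [hne_rs, hne_rt]
  have hs : cs.simple s ∈ cs.parabolic {s, t} := simple_mem_parabolic (by simp)
  have ht : cs.simple t ∈ cs.parabolic {s, t} := simple_mem_parabolic (by simp)
  have hinj {i j : B} (h : cs.simple i = cs.simple j) : i = j := by
    have : cs.simple i ∈ cs.parabolic {j} := h ▸ simple_mem_parabolic rfl
    simpa [simple_mem_parabolic_iff] using this
  have hcomm : cs.simple s * cs.simple r = cs.simple r * cs.simple s := by
    have h := cs.simple_mul_simple_pow r s
    rw [hrs, pow_two, mul_eq_one_iff_eq_inv, mul_inv_rev, inv_simple, inv_simple] at h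
    exact h.symm
  rw [← length_simple_mul_of_mem_parabolic hr hb]
  refine length_mul_of_forall_not_isLeftDescent ?_ ha
  rintro i (rfl | rfl)
  · rw [not_isLeftDescent_iff] at hsb ⊢
    rw [← mul_assoc, hcomm, mul_assoc, length_simple_mul_of_mem_parabolic hr (mul_mem hs hb),
      length_simple_mul_of_mem_parabolic hr hb, hsb]
  · intro h
    obtain ⟨ω, hω, rfl⟩ := exists_wordProd_eq_of_mem_parabolic hb
    rw [← wordProd_cons] at h
    obtain ⟨j, hj, hex⟩ := h.exists_eraseIdx
    rw [wordProd_cons] at hex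
    cases j with
    | zero =>
      rw [List.eraseIdx_cons_zero, ← mul_assoc, mul_eq_right, mul_eq_one_iff_eq_inv,
        inv_simple] at hex
      exact hne_rt (hinj hex).symm
    | succ j =>
      rw [List.eraseIdx_cons_succ, wordProd_cons] at hex
      have hmem : cs.wordProd (ω.eraseIdx j) ∈ cs.parabolic {s, i} :=
        wordProd_mem_parabolic fun i hi ↦ hω i ((List.eraseIdx_sublist ω j).subset hi)
      set x := cs.wordProd (ω.eraseIdx j) * (cs.wordProd ω)⁻¹ with hx
      have hxmem : x ∈ cs.parabolic {s, i} := mul_mem hmem (inv_mem hb)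
      have hrx : cs.simple r * x = cs.simple i * cs.simple r := by
        rw [hx, ← mul_assoc, ← hex]
        group
      -- Comparing lengths in `hrx`, the element `x` is itself a simple reflection.
      have hlen := length_simple_mul_of_mem_parabolic hr hxmem
      have h₁ : cs.length (cs.simple i * cs.simple r) ≤ 2 := by
        simpa using cs.length_mul_le (cs.simple i) (cs.simple r)
      have h₂ : cs.length x ≠ 0 := by
        rw [Ne, length_eq_zero_iff]
        intro h
        rw [h, mul_one, eq_comm, mul_eq_right] at hrx
        simpa [hrx] using cs.length_simple i
      rw [hrx] at hlen
      obtain ⟨k, hk⟩ := cs.length_eq_one_iff.1 (by omega : cs.length x = 1)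
      rw [hk, simple_mem_parabolic_iff] at hxmem
      rw [hk] at hrx
      rcases hxmem with rfl | rfl
      · rw [← hcomm, mul_left_inj] at hrx
        exact hne_st (hinj hrx)
      · have h := cs.dvd_of_simple_mul_simple_pow_eq_one (k := 2) hrt (by
          rw [pow_two]
          nth_rw 2 [hrx]
          simp [mul_assoc])
        have := Nat.le_of_dvd two_pos h
        rw [Nat.dvd_prime Nat.prime_two] at h
        omega

/-! ### Alternating words and dihedral parabolic subgroups -/

@[simp]
theorem length_altWordFrom (i j : B) (n : ℕ) : (altWordFrom i j n).length = n := by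
  induction n generalizing i j with
  | zero => rfl
  | succ n ih => rw [altWordFrom, List.length_cons, ih]

theorem eq_or_eq_of_mem_altWordFrom {i j k : B} {n : ℕ} (h : k ∈ altWordFrom i j n) :
    k = i ∨ k = j := by
  induction n generalizing i j with
  | zero => simp [altWordFrom] at h
  | succ n ih =>
    rw [altWordFrom, List.mem_cons] at h
    exact h.elim .inl fun h ↦ (ih h).symm

theorem altWordFrom_sublist (i j : B) {m n : ℕ} (h : m ≤ n) :
    (altWordFrom i j m).Sublist (altWordFrom i j n) := by
  induction m generalizing i j n with
  | zero => exact List.nil_sublist _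
  | succ m ih =>
    obtain ⟨n, rfl⟩ : ∃ n', n = n' + 1 := ⟨n - 1, by omega⟩
    exact (ih j i (by omega)).cons_cons i

theorem reverse_altWordFrom (i j : B) (n : ℕ) :
    (altWordFrom i j n).reverse = alternatingWord j i n := by
  induction n generalizing i j with
  | zero => rfl
  | succ n ih => rw [altWordFrom, List.reverse_cons, ih, alternatingWord, List.concat_eq_append]

theorem isReduced_altWordFrom {i j : B} (hM : 3 ≤ M i j) {n : ℕ} (hn : n ≤ M i j) :
    cs.IsReduced (altWordFrom i j n) := by
  rw [← isReduced_reverse_iff]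
  apply isReduced_of_nodup_rightInvSeq
  rw [rightInvSeq_reverse, List.nodup_reverse, leftInvSeq_altWordFrom]
  refine List.nodup_range.map_on fun k hk l hl h ↦ ?_
  rw [List.mem_range] at hk hl
  rw [mul_right_inj, pow_inj_mod] at h
  have hdvd := cs.dvd_of_simple_mul_simple_pow_eq_one (i := j) (j := i)
    (.inr (M.symmetric i j ▸ hM)) (pow_orderOf_eq_one _)
  have hpos : 0 < orderOf (cs.simple j * cs.simple i) :=
    Nat.pos_of_ne_zero fun h0 ↦ by
      have := orderOf_dvd_of_pow_eq_one (cs.simple_mul_simple_pow j i)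
      rw [h0, zero_dvd_iff, M.symmetric] at this
      omega
  have hle := Nat.le_of_dvd hpos hdvd
  rw [M.symmetric] at hle
  rwa [Nat.mod_eq_of_lt (by omega), Nat.mod_eq_of_lt (by omega)] at h

theorem wordProd_altWordFrom_braid (i j : B) :
    cs.wordProd (altWordFrom i j (M i j)) = cs.wordProd (altWordFrom j i (M i j)) := by
  rw [← inv_inj, ← wordProd_reverse, ← wordProd_reverse, reverse_altWordFrom, reverse_altWordFrom]
  have h := cs.wordProd_braidWord_eq i j
  rw [braidWord, braidWord, M.symmetric j i] at h
  exact h.symm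

theorem exists_wordProd_eq_altWordFrom {i j : B} {ω : List B} (hω : ∀ k ∈ ω, k = i ∨ k = j) :
    ∃ n ≤ ω.length, cs.wordProd ω = cs.wordProd (altWordFrom i j n) ∨
      cs.wordProd ω = cs.wordProd (altWordFrom j i n) := by
  induction ω with
  | nil => exact ⟨0, le_rfl, .inl rfl⟩
  | cons k ω ih =>
    simp only [List.mem_cons, forall_eq_or_imp] at hω
    obtain ⟨n, hn, h⟩ := ih hω.2
    have step (k k' : B) : ∃ n' ≤ ω.length + 1,
        cs.simple k * cs.wordProd (altWordFrom k k' n) = cs.wordProd (altWordFrom k k' n') ∨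
          cs.simple k * cs.wordProd (altWordFrom k k' n) = cs.wordProd (altWordFrom k' k n') := by
      cases n with
      | zero => exact ⟨1, by omega, .inl rfl⟩
      | succ n =>
        refine ⟨n, by omega, .inr ?_⟩
        rw [altWordFrom, wordProd_cons, simple_mul_simple_cancel_left]
    rw [wordProd_cons, List.length_cons]
    rcases hω.1 with rfl | rfl <;> rcases h with h | h <;> rw [h]
    · exact step _ _
    · exact ⟨n + 1, by omega, .inl rfl⟩
    · exact ⟨n + 1, by omega, .inr rfl⟩
    · obtain ⟨n', hn', h⟩ := step k i
      exact ⟨n', hn', h.symm⟩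

/-- A normal form for products of letters `s` and `t`: an alternating word that starts with `t`,
preceded by a power of `s`. -/
theorem exists_wordProd_eq_pow_mul {s t : B} {ω : List B} (hω : ∀ k ∈ ω, k = s ∨ k = t) :
    ∃ e j, j ≤ ω.length ∧
      cs.wordProd ω = cs.simple s ^ e * cs.wordProd (altWordFrom t s j) := by
  obtain ⟨n, hn, h | h⟩ := exists_wordProd_eq_altWordFrom (cs := cs) hω
  · cases n with
    | zero => exact ⟨0, 0, hn, by rw [h, pow_zero, one_mul]; rfl⟩
    | succ n => exact ⟨1, n, by omega, by rw [h, altWordFrom, wordProd_cons, pow_one]⟩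
  · exact ⟨0, n, hn, by simpa using h⟩

theorem simple_pow_mod_two (s : B) (e : ℕ) : cs.simple s ^ (e % 2) = cs.simple s ^ e :=
  (pow_eq_pow_mod e (cs.simple_sq s)).symm

section Dihedral

variable {s t : B} {c : ℕ}

theorem simple_mul_wordProd_altWordFrom_pred (hst : M s t = c) (hc : 0 < c) :
    cs.simple s * cs.wordProd (altWordFrom t s (c - 1)) = cs.wordProd (altWordFrom t s c) := by
  have h := wordProd_altWordFrom_braid (cs := cs) s t
  rw [hst] at h
  obtain ⟨n, rfl⟩ : ∃ n, c = n + 1 := ⟨c - 1, by omega⟩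
  rw [← h, altWordFrom, wordProd_cons, Nat.add_sub_cancel]

theorem exists_eq_pow_mul_of_mem_parabolic (hst : M s t = c) (hc : 3 ≤ c) {a : W}
    (ha : a ∈ cs.parabolic {s, t}) :
    ∃ e j, e < 2 ∧ j < c ∧ a = cs.simple s ^ e * cs.wordProd (altWordFrom t s j) := by
  obtain ⟨ω, hω, hred, rfl⟩ := exists_isReduced_of_mem_parabolic ha
  obtain ⟨n, hn, h⟩ := exists_wordProd_eq_altWordFrom (cs := cs) (i := s) (j := t) hω
  have hbraid := wordProd_altWordFrom_braid (cs := cs) s t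
  rw [hst] at hbraid
  -- The alternating word for `a` is reduced, so that it is at most as long as the braid word.
  have hnc : n ≤ c := by
    by_contra! hlt
    have hns := cs.not_isReduced_alternatingWord t s (m := n) (by rw [M.symmetric]; omega)
      (by rw [M.symmetric]; omega)
    have hnt := cs.not_isReduced_alternatingWord s t (m := n) (by omega) (by omega)
    rw [← reverse_altWordFrom, isReduced_reverse_iff] at hns hnt
    have hlen := hred.eq
    rcases h with h | h <;> rw [h] at hlen
    · refine hns (le_antisymm (cs.length_wordProd_le _) ?_)
      rwa [hlen, length_altWordFrom]
    · refine hnt (le_antisymm (cs.length_wordProd_le _) ?_)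
      rwa [hlen, length_altWordFrom]
  have hcons (m : ℕ) : cs.wordProd (altWordFrom s t (m + 1)) =
      cs.simple s ^ 1 * cs.wordProd (altWordFrom t s m) := by
    rw [altWordFrom, wordProd_cons, pow_one]
  rcases h with h | h
  · cases n with
    | zero => exact ⟨0, 0, by omega, by omega, by rw [h, pow_zero, one_mul]; rfl⟩
    | succ n => exact ⟨1, n, by omega, by omega, by rw [h, hcons]⟩
  · rcases hnc.lt_or_eq with hlt | rfl
    · exact ⟨0, n, by omega, hlt, by simpa using h⟩
    · refine ⟨1, n - 1, by omega, by omega, ?_⟩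
      rw [h, ← hbraid, ← hcons, Nat.sub_add_cancel (by omega)]

theorem length_simple_pow_mul (hst : M s t = c) (hc : 3 ≤ c) {e j : ℕ} (he : e < 2)
    (hj : j < c) :
    cs.length (cs.simple s ^ e * cs.wordProd (altWordFrom t s j)) = e + j := by
  obtain rfl | rfl : e = 0 ∨ e = 1 := by omega
  · rw [pow_zero, one_mul, (isReduced_altWordFrom (M.symmetric t s ▸ hst ▸ hc)
      (by rw [M.symmetric, hst]; omega)).eq, length_altWordFrom, zero_add]
  · rw [pow_one, ← wordProd_cons, ← altWordFrom, (isReduced_altWordFrom (hst ▸ hc)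
      (by rw [hst]; omega)).eq, length_altWordFrom, add_comm]

theorem not_isLeftDescent_altWordFrom (hst : M s t = c) (hc : 3 ≤ c) {j : ℕ} (hj : j < c) :
    ¬ cs.IsLeftDescent (cs.wordProd (altWordFrom t s j)) s := by
  have h₀ := length_simple_pow_mul (cs := cs) hst hc (e := 0) two_pos hj
  have h₁ := length_simple_pow_mul (cs := cs) hst hc (e := 1) one_lt_two hj
  rw [pow_zero, one_mul] at h₀
  rw [pow_one] at h₁
  rw [not_isLeftDescent_iff]
  omega

/-- The factor `s ^ e` is determined by whether `s` is a left descent, and the alternating word by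
its length. -/
theorem simple_pow_mul_injective (hst : M s t = c) (hc : 3 ≤ c) {e e' j j' : ℕ} (he : e < 2)
    (he' : e' < 2) (hj : j < c) (hj' : j' < c)
    (h : cs.simple s ^ e * cs.wordProd (altWordFrom t s j) =
      cs.simple s ^ e' * cs.wordProd (altWordFrom t s j')) : e = e' ∧ j = j' := by
  have h₁ := congrArg cs.length h
  rw [length_simple_pow_mul hst hc he hj, length_simple_pow_mul hst hc he' hj'] at h₁
  have h₂ := congrArg (fun x ↦ cs.length (cs.simple s * x)) h
  have key {e j : ℕ} (he : e < 2) (hj : j < c) :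
      cs.length (cs.simple s * (cs.simple s ^ e * cs.wordProd (altWordFrom t s j))) =
        1 - e + j := by
    have h₀ := length_simple_pow_mul (cs := cs) hst hc two_pos hj
    have h₁ := length_simple_pow_mul (cs := cs) hst hc one_lt_two hj
    obtain rfl | rfl : e = 0 ∨ e = 1 := by omega
    · rwa [pow_zero, one_mul, ← pow_one (cs.simple s)]
    · rwa [pow_one, simple_mul_simple_cancel_left, ← one_mul (cs.wordProd _),
        ← pow_zero (cs.simple s)]
  simp only [key he hj, key he' hj'] at h₂
  omega

end Dihedral

/-! ### Identities between `q`-integers -/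

theorem qInt_succ (n : ℕ) : qInt (n + 1) = qInt n + X ^ n := Finset.sum_range_succ _ _

theorem X_mul_qInt_add_one (n : ℕ) : X * qInt n + 1 = qInt n + X ^ n := by
  rw [← qInt_succ, qInt, qInt, Finset.sum_range_succ', Finset.mul_sum]
  simp [pow_succ']

theorem qInt_add (m n : ℕ) : qInt (m + n) = qInt m + X ^ m * qInt n := by
  simp only [qInt, Finset.sum_range_add, Finset.mul_sum, pow_add]

theorem qInt_sq (n : ℕ) :
    qInt n * qInt n = ∑ k ∈ Finset.range n, X ^ k * qInt (2 * n - 1 - 2 * k) := by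
  induction n with
  | zero => simp [qInt]
  | succ n ih =>
    have h := X_mul_qInt_add_one n
    have hsum : ∑ k ∈ Finset.range n, X ^ (k + 1) * qInt (2 * (n + 1) - 1 - 2 * (k + 1)) =
        X * (qInt n * qInt n) := by
      rw [ih, Finset.mul_sum]
      refine Finset.sum_congr rfl fun k _ ↦ ?_
      rw [show 2 * (n + 1) - 1 - 2 * (k + 1) = 2 * n - 1 - 2 * k by omega]
      ring
    rw [Finset.sum_range_succ', hsum, show 2 * (n + 1) - 1 - 2 * 0 = n + (n + 1) by omega,
      qInt_add n (n + 1), qInt_succ, ← h]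
    calc (X * qInt n + 1) * (X * qInt n + 1)
        = X * qInt n * (X * qInt n + 1) + (X * qInt n + 1) := by ring
      _ = X * qInt n * (qInt n + X ^ n) + (qInt n + X ^ n) := by rw [h]
      _ = X * (qInt n * qInt n) + X ^ 0 * (qInt n + X ^ n * (X * qInt n + 1)) := by ring

theorem dihedral_add_doubleCoset_eq (c : ℕ) (hc : 0 < c) :
    ((1 + X) * qInt c + X * (1 + X) * (qInt (c - 1) * qInt (c - 1)) : ℕ[X]) =
      qInt (2 * c - 1) + X ^ c +
        ∑ k ∈ Finset.Icc 1 (c - 1), 2 * X ^ k * qInt (2 * c - 1 - 2 * k) := by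
  obtain ⟨n, rfl⟩ : ∃ n, c = n + 1 := ⟨c - 1, by omega⟩
  have h := X_mul_qInt_add_one n
  have hsum : ∑ k ∈ Finset.Icc 1 n, 2 * X ^ k * qInt (2 * (n + 1) - 1 - 2 * k) =
      2 * X * (qInt n * qInt n) := by
    rw [qInt_sq, Finset.mul_sum, Finset.range_eq_Ico, Finset.sum_Ico_eq_sum_range]
    rw [← Finset.Ico_add_one_right_eq_Icc, Finset.sum_Ico_eq_sum_range]
    refine Finset.sum_congr rfl fun k _ ↦ ?_
    rw [show 2 * (n + 1) - 1 - 2 * (1 + k) = 2 * n - 1 - 2 * (0 + k) by omega]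
    ring
  rw [Nat.add_sub_cancel, hsum, show 2 * (n + 1) - 1 = n + (n + 1) by omega, qInt_add n (n + 1),
    qInt_succ, ← h]
  calc (1 + X) * (X * qInt n + 1) + X * (1 + X) * (qInt n * qInt n)
      = X * (qInt n * qInt n) + X * qInt n * (X * qInt n + 1) + X * (X * qInt n + 1) + 1 := by
        ring
    _ = X * (qInt n * qInt n) + X * qInt n * (qInt n + X ^ n) + X * (qInt n + X ^ n) + 1 := by
        rw [h]
    _ = X * qInt n + 1 + X ^ n * (X * qInt n) + X ^ (n + 1) + 2 * X * (qInt n * qInt n) := by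
        ring
    _ = qInt n + X ^ n + X ^ n * (X * qInt n) + X ^ (n + 1) + 2 * X * (qInt n * qInt n) := by
        rw [h]
    _ = qInt n + X ^ n * (X * qInt n + 1) + X ^ (n + 1) + 2 * X * (qInt n * qInt n) := by
        ring

theorem coeff_qInt (n i : ℕ) : (qInt n).coeff i = if i < n then 1 else 0 := by
  simp [qInt, coeff_X_pow]

/-- All terms of the polynomial except `X ^ c` are symmetric about the degree `c - 1`. -/
theorem coeff_symmetric_part {c i : ℕ} (hi : i ≤ 2 * c - 2) (hc : 0 < c) :
    (qInt (2 * c - 1) +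
        ∑ k ∈ Finset.Icc 1 (c - 1), 2 * X ^ k * qInt (2 * c - 1 - 2 * k)).coeff i =
      (qInt (2 * c - 1) +
        ∑ k ∈ Finset.Icc 1 (c - 1), 2 * X ^ k * qInt (2 * c - 1 - 2 * k)).coeff
          (2 * c - 2 - i) := by
  have hterm (k i : ℕ) : (2 * X ^ k * qInt (2 * c - 1 - 2 * k)).coeff i =
      if k ≤ i ∧ i - k < 2 * c - 1 - 2 * k then 2 else 0 := by
    rw [mul_assoc, ← C_ofNat, coeff_C_mul, coeff_X_pow_mul', coeff_qInt, ite_and]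
    simp
  simp only [coeff_add, finsetSum_coeff, hterm, coeff_qInt]
  congr 1
  · rw [if_pos (by omega), if_pos (by omega)]
  · refine Finset.sum_congr rfl fun k _ ↦ ?_
    congr 1
    rw [eq_iff_iff]
    omega

/-! ### The Bruhat interval -/

section Interval

variable {r s t : B} {c : ℕ}

variable (cs) in
/-- The element `s ^ e q_j` of the parabolic subgroup of `{s, t}`, for `p = (e, j)` and
`q_n = t s t ⋯` with `n` letters. -/
def dihedralElem (s t : B) (p : ℕ × ℕ) : W :=
  cs.simple s ^ p.1 * cs.wordProd (altWordFrom t s p.2)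

variable (cs) in
/-- The element `(s ^ e q_i)⁻¹ r q_j` of the double coset of `r` with respect to the parabolic
subgroup of `{s, t}`, for `p = (e, i, j)` and `q_n = t s t ⋯` with `n` letters. -/
def doubleCosetElem (r s t : B) (p : ℕ × ℕ × ℕ) : W :=
  (cs.dihedralElem s t (p.1, p.2.1))⁻¹ * (cs.simple r * cs.wordProd (altWordFrom t s p.2.2))

variable (hrs : M r s = 2) (hrt : M r t = 0 ∨ 3 ≤ M r t) (hst : M s t = c) (hc : 3 ≤ c)

theorem dihedralElem_mem_parabolic (p : ℕ × ℕ) :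
    cs.dihedralElem s t p ∈ cs.parabolic {s, t} :=
  mul_mem (pow_mem (simple_mem_parabolic (by simp)) p.1)
    (wordProd_mem_parabolic fun k hk ↦ by simpa [or_comm] using eq_or_eq_of_mem_altWordFrom hk)

theorem wordProd_altWordFrom_mem_parabolic (n : ℕ) :
    cs.wordProd (altWordFrom t s n) ∈ cs.parabolic {s, t} := by
  simpa [dihedralElem] using dihedralElem_mem_parabolic (cs := cs) (s := s) (t := t) (0, n)

include hst hc in
theorem injOn_dihedralElem :
    Set.InjOn (cs.dihedralElem s t) (Finset.range 2 ×ˢ Finset.range c : Finset (ℕ × ℕ)) := by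
  rintro ⟨e, j⟩ hp ⟨e', j'⟩ hp' h
  simp only [Finset.coe_product, Finset.coe_range, Set.mem_prod, Set.mem_Iio] at hp hp'
  obtain ⟨rfl, rfl⟩ := simple_pow_mul_injective hst hc hp.1 hp'.1 hp.2 hp'.2 h
  rfl

include hst hc in
theorem length_dihedralElem {p : ℕ × ℕ} (h₁ : p.1 < 2) (h₂ : p.2 < c) :
    cs.length (cs.dihedralElem s t p) = p.1 + p.2 :=
  length_simple_pow_mul hst hc h₁ h₂

theorem length_mul_simple_mul_altWordFrom (hrs : M r s = 2) (hrt : M r t = 0 ∨ 3 ≤ M r t)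
    (hst : M s t = c) (hc : 3 ≤ c) {a : W} (ha : a ∈ cs.parabolic {s, t}) {j : ℕ} (hj : j < c) :
    cs.length (a * (cs.simple r * cs.wordProd (altWordFrom t s j))) = cs.length a + (j + 1) := by
  have h := length_dihedralElem (cs := cs) hst hc (p := (0, j)) two_pos hj
  rw [dihedralElem, pow_zero, one_mul, zero_add] at h
  rw [length_mul_simple_mul hrs hrt ha (wordProd_altWordFrom_mem_parabolic j)
    (not_isLeftDescent_altWordFrom hst hc hj), h]

include hrs hrt hst hc

theorem length_doubleCosetElem {p : ℕ × ℕ × ℕ} (h₁ : p.1 < 2) (h₂ : p.2.1 < c)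
    (h₃ : p.2.2 < c) :
    cs.length (cs.doubleCosetElem r s t p) = p.1 + p.2.1 + (p.2.2 + 1) := by
  rw [doubleCosetElem, length_mul_simple_mul_altWordFrom hrs hrt hst hc
    (inv_mem (dihedralElem_mem_parabolic (p.1, p.2.1))) h₃, length_inv,
    length_dihedralElem hst hc h₁ h₂]

/-- Elements `r q_j` of the same left coset of the parabolic subgroup coincide, because each of
them has the minimal length in its coset. -/
theorem injOn_doubleCosetElem : Set.InjOn (cs.doubleCosetElem r s t)
    (Finset.range 2 ×ˢ Finset.range (c - 1) ×ˢ Finset.range (c - 1) : Finset (ℕ × ℕ × ℕ)) := by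
  rintro ⟨e, i, j⟩ hp ⟨e', i', j'⟩ hp' h
  simp only [Finset.coe_product, Finset.coe_range, Set.mem_prod, Set.mem_Iio] at hp hp'
  obtain ⟨he, hi, hj⟩ := hp
  obtain ⟨he', hi', hj'⟩ := hp'
  have ha := dihedralElem_mem_parabolic (cs := cs) (s := s) (t := t) (e, i)
  have ha' := dihedralElem_mem_parabolic (cs := cs) (s := s) (t := t) (e', i')
  simp only [doubleCosetElem] at h
  set a := cs.dihedralElem s t (e, i) with ha_def
  set a' := cs.dihedralElem s t (e', i') with ha'_def
  have key {j : ℕ} (hj : j < c - 1) {b : W} (hb : b ∈ cs.parabolic {s, t}) :=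
    length_mul_simple_mul_altWordFrom hrs hrt hst hc hb (show j < c by omega)
  have h₁ := key hj' (mul_mem ha (inv_mem ha'))
  have h₂ := key hj (mul_mem ha' (inv_mem ha))
  have h₃ := key hj (one_mem _)
  have h₄ := key hj' (one_mem _)
  rw [mul_assoc, ← h, mul_inv_cancel_left] at h₁
  rw [mul_assoc, h, mul_inv_cancel_left] at h₂
  rw [one_mul, length_one, zero_add] at h₃ h₄
  have haa' : a = a' := by
    rw [← mul_inv_eq_one, ← cs.length_eq_zero_iff]
    omega
  obtain ⟨rfl, rfl⟩ := simple_pow_mul_injective hst hc he he' (by omega) (by omega) haa'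
  obtain rfl : j = j' := by
    rw [← haa', mul_inv_cancel, length_one] at h₁
    omega
  rfl

omit hst hc in
theorem doubleCosetElem_not_mem_parabolic (p : ℕ × ℕ × ℕ) :
    cs.doubleCosetElem r s t p ∉ cs.parabolic {s, t} := by
  rw [doubleCosetElem, Subgroup.mul_mem_cancel_left _
    (inv_mem (dihedralElem_mem_parabolic (p.1, p.2.1))), Subgroup.mul_mem_cancel_right _
    (wordProd_altWordFrom_mem_parabolic _), simple_mem_parabolic_iff]
  rintro (rfl | rfl)
  · simp at hrs
  · simp at hrt

variable (r s t c) in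
/-- The reduced word `⋯ t s t s` (`c - 1` letters), `r`, `t s t ⋯` (`c - 2` letters) of the element
`w = u v`. -/
def doubleCosetWord : List B :=
  (altWordFrom s t (c - 1)).reverse ++ r :: altWordFrom t s (c - 2)

omit hrs hrt hst in
theorem wordProd_doubleCosetWord :
    cs.wordProd (doubleCosetWord r s t c) = cs.doubleCosetElem r s t (1, c - 2, c - 2) := by
  rw [doubleCosetWord, show c - 1 = c - 2 + 1 by omega, altWordFrom, wordProd_append,
    wordProd_cons, wordProd_reverse, wordProd_cons, doubleCosetElem, dihedralElem, pow_one]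

theorem length_wordProd_doubleCosetWord :
    cs.length (cs.wordProd (doubleCosetWord r s t c)) = 2 * c - 2 := by
  rw [wordProd_doubleCosetWord hc, length_doubleCosetElem hrs hrt hst hc one_lt_two
    (show c - 2 < c by omega) (show c - 2 < c by omega)]
  dsimp only
  omega

theorem isReduced_doubleCosetWord : cs.IsReduced (doubleCosetWord r s t c) := by
  rw [IsReduced, length_wordProd_doubleCosetWord hrs hrt hst hc, doubleCosetWord,
    List.length_append, List.length_reverse, List.length_cons, length_altWordFrom,
    length_altWordFrom]
  omega

omit hrs hrt hst in
/-- The words of the elements `(s ^ e q_i)⁻¹ r q_j` with `i, j ≤ c - 2` are subwords. -/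
theorem exists_sublist_doubleCosetElem {p : ℕ × ℕ × ℕ} (h₁ : p.1 < 2) (h₂ : p.2.1 < c - 1)
    (h₃ : p.2.2 < c - 1) : ∃ ω, ω.Sublist (doubleCosetWord r s t c) ∧
      cs.wordProd ω = cs.doubleCosetElem r s t p := by
  refine ⟨(List.replicate p.1 s ++ altWordFrom t s p.2.1).reverse ++ r :: altWordFrom t s p.2.2,
    ?_, ?_⟩
  · refine List.Sublist.append (List.reverse_sublist.2 ?_)
      ((altWordFrom_sublist t s (by omega)).cons_cons r)
    rw [show c - 1 = c - 2 + 1 by omega, altWordFrom, ← List.singleton_append]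
    refine List.Sublist.append ?_ (altWordFrom_sublist t s (by omega))
    exact (List.replicate_sublist_replicate s).2 (show p.1 ≤ 1 by omega)
  · rw [wordProd_append, wordProd_cons, wordProd_reverse, wordProd_append, doubleCosetElem,
      dihedralElem]
    simp [wordProd]

omit hrs hrt in
/-- The words of the elements of the parabolic subgroup of `{s, t}` are subwords of the braid word
`t s t ⋯` with `c` letters, which itself consists of the letters `t s` before `r` and of the letters
after `r`. -/
theorem exists_sublist_dihedralElem {p : ℕ × ℕ} (h₁ : p.1 < 2) (h₂ : p.2 < c) :
    ∃ ω, ω.Sublist (doubleCosetWord r s t c) ∧ cs.wordProd ω = cs.dihedralElem s t p := by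
  have hsub : (altWordFrom t s c).Sublist (doubleCosetWord r s t c) := by
    obtain ⟨n, rfl⟩ : ∃ n, c = n + 3 := ⟨c - 3, by omega⟩
    have : ([t] ++ [s] ++ altWordFrom t s (n + 1)).Sublist (doubleCosetWord r s t (n + 3)) := by
      refine List.Sublist.append ?_ (List.sublist_cons_self _ _)
      simp [altWordFrom]
    simpa [altWordFrom] using this
  obtain ⟨e, j⟩ := p
  dsimp only at h₁ h₂
  obtain rfl | rfl : e = 0 ∨ e = 1 := by omega
  · exact ⟨altWordFrom t s j, (altWordFrom_sublist t s h₂.le).trans hsub, by simp [dihedralElem]⟩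
  · obtain hj | rfl : j < c - 1 ∨ j = c - 1 := by omega
    · refine ⟨altWordFrom s t (j + 1), .trans ?_ hsub, by
        rw [dihedralElem, altWordFrom, wordProd_cons, pow_one]⟩
      obtain ⟨n, rfl⟩ : ∃ n, c = n + 1 := ⟨c - 1, by omega⟩
      exact (altWordFrom_sublist s t (by omega)).trans (List.sublist_cons_self t _)
    · refine ⟨altWordFrom t s c, hsub, ?_⟩
      rw [dihedralElem, pow_one, simple_mul_wordProd_altWordFrom_pred hst (by omega)]

omit hrs hrt in
theorem exists_dihedralElem_eq {a : W} (ha : a ∈ cs.parabolic {s, t}) :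
    ∃ p ∈ Finset.range 2 ×ˢ Finset.range c, cs.dihedralElem s t p = a := by
  obtain ⟨e, j, he, hj, rfl⟩ := exists_eq_pow_mul_of_mem_parabolic hst hc ha
  exact ⟨(e, j), by simp [he, hj], rfl⟩

omit hrt hst in
/-- A subword that contains the letter `r` has a product of the form `(s ^ e q_i)⁻¹ r (s ^ e' q_j)`
with `i, j ≤ c - 2`, and `s ^ e'` can be moved to the left of `r`. -/
theorem exists_doubleCosetElem_eq {l₁ l₂ : List B} (h₁ : l₁.Sublist (altWordFrom s t (c - 1)))
    (h₂ : l₂.Sublist (altWordFrom t s (c - 2))) :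
    ∃ p ∈ Finset.range 2 ×ˢ Finset.range (c - 1) ×ˢ Finset.range (c - 1),
      cs.doubleCosetElem r s t p = (cs.wordProd l₁)⁻¹ * (cs.simple r * cs.wordProd l₂) := by
  have hmem {l : List B} (hl : l.Sublist (altWordFrom t s (c - 2))) : ∃ e j, j < c - 1 ∧
      cs.wordProd l = cs.simple s ^ e * cs.wordProd (altWordFrom t s j) := by
    obtain ⟨e, j, hj, h⟩ := exists_wordProd_eq_pow_mul (cs := cs) (s := s) (t := t) (ω := l)
      fun k hk ↦ (eq_or_eq_of_mem_altWordFrom (hl.subset hk)).symm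
    have := hl.length_le
    rw [length_altWordFrom] at this
    exact ⟨e, j, by omega, h⟩
  have hl₁ : ∃ e i, i < c - 1 ∧
      cs.wordProd l₁ = cs.simple s ^ e * cs.wordProd (altWordFrom t s i) := by
    rw [show c - 1 = c - 2 + 1 by omega, altWordFrom, List.sublist_cons_iff] at h₁
    rcases h₁ with h₁ | ⟨l, rfl, h₁⟩
    · exact hmem h₁
    · obtain ⟨e, i, hi, h⟩ := hmem h₁
      exact ⟨e + 1, i, hi, by rw [wordProd_cons, h, pow_succ', mul_assoc]⟩
  obtain ⟨e, i, hi, h⟩ := hl₁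
  obtain ⟨e', j, hj, h'⟩ := hmem h₂
  have hcomm : Commute (cs.simple r) (cs.simple s) := by
    have h := cs.simple_mul_simple_pow r s
    rwa [hrs, pow_two, mul_eq_one_iff_eq_inv, mul_inv_rev, inv_simple, inv_simple] at h
  have hinv : (cs.simple s ^ e')⁻¹ = cs.simple s ^ e' := by rw [← inv_pow, inv_simple]
  refine ⟨((e' + e) % 2, i, j), by simp [Nat.mod_lt _ two_pos, hi, hj, -Order.lt_two_iff], ?_⟩
  rw [doubleCosetElem, dihedralElem, h, h', simple_pow_mod_two, pow_add, mul_assoc,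
    mul_inv_rev _ (_ * _), hinv, ← mul_assoc (cs.simple r), (hcomm.pow_right e').eq]
  simp only [mul_assoc]

/-- The Bruhat interval below `w`: the whole parabolic subgroup of `{s, t}`, and part of the double
coset of `r`. -/
theorem bruhatLE_doubleCosetWord_iff {x : W} :
    cs.BruhatLE x (cs.wordProd (doubleCosetWord r s t c)) ↔
      (∃ p ∈ Finset.range 2 ×ˢ Finset.range c, cs.dihedralElem s t p = x) ∨
      ∃ p ∈ Finset.range 2 ×ˢ Finset.range (c - 1) ×ˢ Finset.range (c - 1),
        cs.doubleCosetElem r s t p = x := by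
  rw [(isReduced_doubleCosetWord hrs hrt hst hc).bruhatLE_iff]
  constructor
  · rintro ⟨ω, hω, rfl⟩
    obtain ⟨l₁, l₂, rfl, h₁, h₂⟩ := List.sublist_append_iff.1 hω
    rcases List.sublist_cons_iff.1 h₂ with h₂ | ⟨l₃, rfl, h₃⟩
    · refine .inl (exists_dihedralElem_eq hst hc (wordProd_mem_parabolic fun k hk ↦ ?_))
      rcases List.mem_append.1 hk with hk | hk
      · exact eq_or_eq_of_mem_altWordFrom (List.mem_reverse.1 (h₁.subset hk))
      · exact (eq_or_eq_of_mem_altWordFrom (h₂.subset hk)).symm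
    · refine .inr ?_
      obtain ⟨p, hp, h⟩ := exists_doubleCosetElem_eq (cs := cs) hrs hc
        (List.reverse_sublist.1 (by rwa [List.reverse_reverse])) h₃ (l₁ := l₁.reverse)
      refine ⟨p, hp, ?_⟩
      rw [h, wordProd_reverse, inv_inv, wordProd_append, wordProd_cons]
  · rintro (⟨p, hp, rfl⟩ | ⟨p, hp, rfl⟩) <;> simp only [Finset.mem_product, Finset.mem_range] at hp
    · exact exists_sublist_dihedralElem hst hc hp.1 hp.2
    · exact exists_sublist_doubleCosetElem hc hp.1 hp.2.1 hp.2.2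

theorem poincarePolynomial_doubleCosetWord [Finite B] :
    cs.poincarePolynomial (cs.wordProd (doubleCosetWord r s t c)) =
      (1 + X) * qInt c + X * (1 + X) * (qInt (c - 1) * qInt (c - 1)) := by
  classical
  have hset : (cs.finite_bruhatInterval (cs.wordProd (doubleCosetWord r s t c))).toFinset =
      (Finset.range 2 ×ˢ Finset.range c).image (cs.dihedralElem s t) ∪
      (Finset.range 2 ×ˢ Finset.range (c - 1) ×ˢ Finset.range (c - 1)).image
        (cs.doubleCosetElem r s t) := by
    ext x
    rw [Set.Finite.mem_toFinset, Set.mem_ofPred_eq, bruhatLE_doubleCosetWord_iff hrs hrt hst hc,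
      Finset.mem_union, Finset.mem_image, Finset.mem_image]
  have hdisj : Disjoint ((Finset.range 2 ×ˢ Finset.range c).image (cs.dihedralElem s t))
      ((Finset.range 2 ×ˢ Finset.range (c - 1) ×ˢ Finset.range (c - 1)).image
        (cs.doubleCosetElem r s t)) := by
    simp only [Finset.disjoint_left, Finset.mem_image, not_exists, not_and]
    rintro x ⟨p, _, rfl⟩ p' _ h
    exact doubleCosetElem_not_mem_parabolic hrs hrt p' (h ▸ dihedralElem_mem_parabolic p)
  rw [poincarePolynomial, hset, Finset.sum_union hdisj,
    Finset.sum_image (injOn_dihedralElem hst hc),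
    Finset.sum_image (injOn_doubleCosetElem hrs hrt hst hc)]
  congr 1
  · rw [Finset.sum_congr rfl fun p hp ↦ show _ = (X : ℕ[X]) ^ p.1 * X ^ p.2 by
      simp only [Finset.mem_product, Finset.mem_range] at hp
      rw [length_dihedralElem hst hc hp.1 hp.2, pow_add], Finset.sum_product, ← Finset.sum_mul_sum]
    simp [qInt, Finset.sum_range_succ]
  · rw [Finset.sum_congr rfl fun p hp ↦ show _ = (X : ℕ[X]) ^ p.1 * (X ^ p.2.1 * X ^ p.2.2 * X) by
      simp only [Finset.mem_product, Finset.mem_range] at hp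
      rw [length_doubleCosetElem hrs hrt hst hc hp.1 (by omega) (by omega)]
      ring]
    simp only [Finset.sum_product, ← Finset.mul_sum, ← Finset.sum_mul]
    simp only [qInt, Finset.sum_range_succ, Finset.sum_range_zero]
    ring

end Interval

end CoxeterSystem

/-- `W` is a triangle group `(2, b, c)` with generators indexed by `r, s, t` (distinct, because of
the values of the Coxeter matrix); an entry `0` of a Coxeter matrix stands for `∞`. -/
theorem proposition4p1 {B W : Type*} [Finite B] [Group W] {M : CoxeterMatrix B}
    (cs : CoxeterSystem M W) (r s t : B) (hS : ({r, s, t} : Set B) = Set.univ) (c : ℕ)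
    (hrs : M r s = 2) (hrt : M r t = 0 ∨ 3 ≤ M r t) (hst : M s t = c) (hc : 3 ≤ c) :
    ∃ w u v : W, w = u * v ∧
      u⁻¹ = cs.wordProd (CoxeterSystem.altWordFrom s t (c - 1)) ∧
      v = cs.wordProd (r :: CoxeterSystem.altWordFrom t s (c - 2)) ∧
      cs.length u = c - 1 ∧ cs.length v = c - 1 ∧ cs.length w = 2 * c - 2 ∧
      cs.poincarePolynomial w =
        CoxeterSystem.qInt (2 * c - 1) + X ^ c +
          ∑ k ∈ Finset.Icc 1 (c - 1), 2 * X ^ k * CoxeterSystem.qInt (2 * c - 1 - 2 * k) ∧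
      cs.IsKPalindromic (c - 2) w ∧ ¬ cs.IsPalindromic w := by
  have hw := CoxeterSystem.isReduced_doubleCosetWord (cs := cs) hrs hrt hst hc
  have hlen := CoxeterSystem.length_wordProd_doubleCosetWord (cs := cs) hrs hrt hst hc
  have hP := CoxeterSystem.poincarePolynomial_doubleCosetWord (cs := cs) hrs hrt hst hc
  rw [CoxeterSystem.dihedral_add_doubleCoset_eq c (by omega)] at hP
  have hP' := hP
  rw [add_right_comm] at hP'
  have hsymm {i : ℕ} (hi : i ≤ 2 * c - 2) :=
    CoxeterSystem.coeff_symmetric_part hi (show 0 < c by omega)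
  refine ⟨cs.wordProd (CoxeterSystem.doubleCosetWord r s t c),
    cs.wordProd (CoxeterSystem.altWordFrom s t (c - 1)).reverse, _,
    cs.wordProd_append _ _, ?_, rfl, ?_, ?_, hlen, hP, ?_, ?_⟩
  · rw [cs.wordProd_reverse, inv_inv]
  · have h : cs.IsReduced (CoxeterSystem.altWordFrom s t (c - 1)).reverse := by
      simpa [CoxeterSystem.doubleCosetWord] using hw.take (c - 1)
    rw [h.eq, List.length_reverse, CoxeterSystem.length_altWordFrom]
  · have h : cs.IsReduced (r :: CoxeterSystem.altWordFrom t s (c - 2)) := by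
      simpa [CoxeterSystem.doubleCosetWord] using hw.drop (c - 1)
    rw [h.eq, List.length_cons, CoxeterSystem.length_altWordFrom]
    omega
  · intro i hi hil
    rw [hlen] at hil ⊢
    rw [hP', coeff_add _ (X ^ c), coeff_add _ (X ^ c), hsymm hil, coeff_X_pow, coeff_X_pow,
      if_neg (by omega), if_neg (by omega)]
  · intro h
    specialize h c (by omega)
    rw [hlen, hP', coeff_add _ (X ^ c), coeff_add _ (X ^ c), hsymm (by omega), coeff_X_pow,
      coeff_X_pow, if_pos rfl, if_neg (by omega)] at h
    omega
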